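/- Consider the simply typed $\lambda$-calculus with types generated by one base type $o$, function types, binary products and the unit type, with the usual $\beta\eta$-conversion. For a simple type $A$, let $\mathrm{Tm}(A)$ be the set of closed terms of type $A$ modulo $\beta\eta$-conversion. For a set $Q$, let $[\![A]\!]_Q$ be the naive set-theoretic interpretation of $A$ with $[\![o]\!]_Q = Q$, and for $t \in \mathrm{Tm}(A)$ let $[\![t]\!]_Q \in [\![A]\!]_Q$ be its interpretation. A language $L \subseteq \mathrm{Tm}(A)$ is *recognizable in* $\mathrm{FinSet}$ if there are a finite set $Q$ and a subset $F \subseteq [\![A]\!]_Q$ with $L = \mathcal L(F) := \{t \in \mathrm{Tm}(A) \mid [\![t]\!]_Q \in F\}$. Let $U := ((o\to o)\to o)\to(o\to o\to o)\to o$. A closed untyped $\lambda$-term $u$ (a syntax tree with binders modulo $\alpha$-renaming, without $\beta$-conversion) is encoded as $\mathrm{enc}(u) := \lambda \ell.\,\lambda a.\,\langle u\rangle \in \mathrm{Tm}(U)$, where $\langle x\rangle := x$, $\langle \lambda x.\,v\rangle := \ell\,(\lambda (x:o).\,\langle v\rangle)$ and $\langle v\,w\rangle := a\,\langle v\rangle\,\langle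 w\rangle$. The term $u$ is *affine* if every bound variable of $u$ occurs at most once. Let $L \subseteq \mathrm{Tm}(U)$ be the set of encodings of closed affine untyped terms. Let $Q := \{0,1,\infty\}\times\{\top,\bot\}$, where $\{0,1,\infty\}$ is the additive monoid $\mathbb N$ truncated by $2 = 3 = \dots = \infty$, and define $f_{\mathrm{app}} : Q \to (Q \to Q)$ and $f_{\mathrm{abs}} : (Q\to Q)\to Q$ by $$f_{\mathrm{app}}(k,b)(k',b') := (k+k',\, b\wedge b'), \qquad f_{\mathrm{abs}}(g) := \bigl(g(0,\top)_1,\; g(0,\top)_2 \wedge (g(1,\top)_1 \neq \infty)\bigr).$$ **Theorem.** 1. The map $u \mapsto \mathrm{enc}(u)$ is a bijection from the set of closed untyped $\lambda$-terms to $\mathrm{Tm}(U)$. 2. For every closed untyped $\lambda$-term $u$, $[\![\mathrm{enc}(u)]\!]_Q(f_{\mathrm{abs}})(f_{\mathrm{app}}) = (0,b)$, where $b = \top$ if and only if $u$ is affine. 3. $L = \mathcal L(\{s \in [\![U]\!]_Q \mid s(f_{\mathrm{abs}})(f_{\mathrm{app}}) = (0,\top)\}) = \mathcal L(\{s \in [\![U]\!]_Q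 \mid s(f_{\mathrm{abs}})(f_{\mathrm{app}})_2 = \top\})$. 4. In particular, $L$ is recognizable in $\mathrm{FinSet}$. -/

import Mathlib

namespace AffineLang

/-! ### The simply typed lambda-calculus with products and unit, modulo beta-eta -/

/-- Simple types over one base type `o`. -/
inductive Ty : Type
  | o : Ty
  | arr : Ty → Ty → Ty
  | prod : Ty → Ty → Ty
  | unit : Ty

/-- Typing contexts; the most recently bound variable comes first. -/
abbrev Ctx : Type := List Ty

/-- `Var Γ A`: the variables (de Bruijn indices) of type `A` in the context `Γ`. -/
inductive Var : Ctx → Ty → Type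
  | here {Γ : Ctx} {A : Ty} : Var (A :: Γ) A
  | there {Γ : Ctx} {A B : Ty} : Var Γ A → Var (B :: Γ) A

/-- `Term Γ A`: the simply typed terms of type `A` in context `Γ`, up to renaming of bound
variables. -/
inductive Term : Ctx → Ty → Type
  | var {Γ : Ctx} {A : Ty} : Var Γ A → Term Γ A
  | lam {Γ : Ctx} (A : Ty) {B : Ty} : Term (A :: Γ) B → Term Γ (Ty.arr A B)
  | app {Γ : Ctx} {A B : Ty} : Term Γ (Ty.arr A B) → Term Γ A → Term Γ B
  | pair {Γ : Ctx} {A B : Ty} : Term Γ A → Term Γ B → Term Γ (Ty.prod A B)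
  | fst {Γ : Ctx} {A B : Ty} : Term Γ (Ty.prod A B) → Term Γ A
  | snd {Γ : Ctx} {A B : Ty} : Term Γ (Ty.prod A B) → Term Γ B
  | star {Γ : Ctx} : Term Γ Ty.unit

/-- Renamings of the variables of `Γ` by variables of `Δ`. -/
abbrev Ren (Γ Δ : Ctx) : Type := ∀ A : Ty, Var Γ A → Var Δ A

/-- Substitutions of terms in context `Δ` for the variables of `Γ`. -/
abbrev Subst (Γ Δ : Ctx) : Type := ∀ A : Ty, Var Γ A → Term Δ A

/-- Extension of a renaming under a binder. -/
def Ren.lift {Γ Δ : Ctx} (ρ : Ren Γ Δ) (B : Ty) : Ren (B :: Γ) (B :: Δ)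
  | _, Var.here => Var.here
  | _, Var.there x => Var.there (ρ _ x)

/-- Action of a renaming on terms. -/
def Term.rename : {Γ Δ : Ctx} → {A : Ty} → Ren Γ Δ → Term Γ A → Term Δ A
  | _, _, _, ρ, Term.var x => Term.var (ρ _ x)
  | _, _, _, ρ, Term.lam A t => Term.lam A (Term.rename (Ren.lift ρ A) t)
  | _, _, _, ρ, Term.app t u => Term.app (Term.rename ρ t) (Term.rename ρ u)
  | _, _, _, ρ, Term.pair t u => Term.pair (Term.rename ρ t) (Term.rename ρ u)
  | _, _, _, ρ, Term.fst t => Term.fst (Term.rename ρ t)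
  | _, _, _, ρ, Term.snd t => Term.snd (Term.rename ρ t)
  | _, _, _, _, Term.star => Term.star

/-- Weakening by one fresh variable. -/
def Term.weaken {Γ : Ctx} {A : Ty} (B : Ty) (t : Term Γ A) : Term (B :: Γ) A :=
  Term.rename (fun _ x => Var.there x) t

/-- Extension of a substitution under a binder. -/
def Subst.lift {Γ Δ : Ctx} (σ : Subst Γ Δ) (B : Ty) : Subst (B :: Γ) (B :: Δ)
  | _, Var.here => Term.var Var.here
  | _, Var.there x => Term.weaken B (σ _ x)

/-- Simultaneous capture-avoiding substitution. -/
def Term.subst : {Γ Δ : Ctx} → {A : Ty} → Subst Γ Δ → Term Γ A → Term Δ A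
  | _, _, _, σ, Term.var x => σ _ x
  | _, _, _, σ, Term.lam A t => Term.lam A (Term.subst (Subst.lift σ A) t)
  | _, _, _, σ, Term.app t u => Term.app (Term.subst σ t) (Term.subst σ u)
  | _, _, _, σ, Term.pair t u => Term.pair (Term.subst σ t) (Term.subst σ u)
  | _, _, _, σ, Term.fst t => Term.fst (Term.subst σ t)
  | _, _, _, σ, Term.snd t => Term.snd (Term.subst σ t)
  | _, _, _, _, Term.star => Term.star

/-- The substitution that replaces the most recent variable by `u`. -/
def Subst.single {Γ : Ctx} {B : Ty} (u : Term Γ B) : Subst (B :: Γ) Γ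
  | _, Var.here => u
  | _, Var.there x => Term.var x

/-- `t.inst u` is `t[u/x]`, for `x` the most recent variable. -/
def Term.inst {Γ : Ctx} {A B : Ty} (t : Term (B :: Γ) A) (u : Term Γ B) : Term Γ A :=
  Term.subst (Subst.single u) t

/-- Typed beta-eta-conversion: the least congruence containing the beta and eta rules for
function, product and unit types. -/
inductive Conv : {Γ : Ctx} → {A : Ty} → Term Γ A → Term Γ A → Prop
  | refl {Γ : Ctx} {A : Ty} (t : Term Γ A) : Conv t t
  | symm {Γ : Ctx} {A : Ty} {t u : Term Γ A} : Conv t u → Conv u t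
  | trans {Γ : Ctx} {A : Ty} {t u v : Term Γ A} : Conv t u → Conv u v → Conv t v
  | lam {Γ : Ctx} {A B : Ty} {t t' : Term (A :: Γ) B} :
      Conv t t' → Conv (Term.lam A t) (Term.lam A t')
  | app {Γ : Ctx} {A B : Ty} {t t' : Term Γ (Ty.arr A B)} {u u' : Term Γ A} :
      Conv t t' → Conv u u' → Conv (Term.app t u) (Term.app t' u')
  | pair {Γ : Ctx} {A B : Ty} {t t' : Term Γ A} {u u' : Term Γ B} :
      Conv t t' → Conv u u' → Conv (Term.pair t u) (Term.pair t' u')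
  | fst {Γ : Ctx} {A B : Ty} {t t' : Term Γ (Ty.prod A B)} :
      Conv t t' → Conv (Term.fst t) (Term.fst t')
  | snd {Γ : Ctx} {A B : Ty} {t t' : Term Γ (Ty.prod A B)} :
      Conv t t' → Conv (Term.snd t) (Term.snd t')
  | arr_beta {Γ : Ctx} {A B : Ty} (t : Term (A :: Γ) B) (u : Term Γ A) :
      Conv (Term.app (Term.lam A t) u) (Term.inst t u)
  | arr_eta {Γ : Ctx} {A B : Ty} (t : Term Γ (Ty.arr A B)) :
      Conv t (Term.lam A (Term.app (Term.weaken A t) (Term.var Var.here)))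
  | fst_beta {Γ : Ctx} {A B : Ty} (t : Term Γ A) (u : Term Γ B) :
      Conv (Term.fst (Term.pair t u)) t
  | snd_beta {Γ : Ctx} {A B : Ty} (t : Term Γ A) (u : Term Γ B) :
      Conv (Term.snd (Term.pair t u)) u
  | prod_eta {Γ : Ctx} {A B : Ty} (t : Term Γ (Ty.prod A B)) :
      Conv t (Term.pair (Term.fst t) (Term.snd t))
  | unit_eta {Γ : Ctx} (t : Term Γ Ty.unit) : Conv t Term.star

/-- Beta-eta-conversion of closed terms of type `A`, as an equivalence relation. -/
def convSetoid (A : Ty) : Setoid (Term [] A) where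
  r := fun t u => Conv t u
  iseqv := ⟨Conv.refl, Conv.symm, Conv.trans⟩

/-- The set of closed simply typed terms of type `A`, modulo beta-eta-conversion. -/
def Tm (A : Ty) : Type := Quotient (convSetoid A)

/-! ### Set-theoretic semantics and recognizable languages -/

/-- The interpretation of a type when the base type is interpreted by the set `Q`. -/
def SemTy (Q : Type) : Ty → Type
  | Ty.o => Q
  | Ty.arr A B => SemTy Q A → SemTy Q B
  | Ty.prod A B => SemTy Q A × SemTy Q B
  | Ty.unit => Unit

/-- Valuations of the variables of a context. -/
abbrev Env (Q : Type) (Γ : Ctx) : Type := ∀ A : Ty, Var Γ A → SemTy Q A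

/-- Extension of a valuation by a value for a fresh variable. -/
def Env.cons {Q : Type} {Γ : Ctx} {B : Ty} (q : SemTy Q B) (e : Env Q Γ) : Env Q (B :: Γ)
  | _, Var.here => q
  | _, Var.there x => e _ x

/-- The empty valuation. -/
def Env.nil {Q : Type} : Env Q [] := fun _ x => nomatch x

/-- The set-theoretic interpretation of terms. -/
def Term.sem {Q : Type} : {Γ : Ctx} → {A : Ty} → Term Γ A → Env Q Γ → SemTy Q A
  | _, _, Term.var x, e => e _ x
  | _, _, Term.lam _ t, e => fun q => Term.sem t (Env.cons q e)
  | _, _, Term.app t u, e => (Term.sem t e) (Term.sem u e)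
  | _, _, Term.pair t u, e => (Term.sem t e, Term.sem u e)
  | _, _, Term.fst t, e => (Term.sem t e).1
  | _, _, Term.snd t, e => (Term.sem t e).2
  | _, _, Term.star, _ => ()

theorem Term.sem_rename {Q : Type} {Γ : Ctx} {A : Ty} (t : Term Γ A) :
    ∀ {Δ : Ctx} (ρ : Ren Γ Δ) (e : Env Q Δ),
      (t.rename ρ).sem e = t.sem (fun B x => e B (ρ B x)) := by
  induction t with
  | var x => intros; rfl
  | lam B t ih =>
    intro Δ ρ e
    funext q
    simp only [Term.rename, Term.sem, ih]
    congr 1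
    funext C x
    cases x <;> rfl
  | app t u iht ihu => intro Δ ρ e; simp only [Term.rename, Term.sem, iht, ihu]
  | pair t u iht ihu => intro Δ ρ e; exact Prod.ext (iht ρ e) (ihu ρ e)
  | fst t ih => intro Δ ρ e; simp only [Term.rename, Term.sem, ih]
  | snd t ih => intro Δ ρ e; simp only [Term.rename, Term.sem, ih]
  | star => intros; rfl

theorem Term.sem_weaken {Q : Type} {Γ : Ctx} {A B : Ty} (t : Term Γ A) (q : SemTy Q B)
    (e : Env Q Γ) : (t.weaken B).sem (Env.cons q e) = t.sem e :=
  t.sem_rename _ _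

theorem Term.sem_subst {Q : Type} {Γ : Ctx} {A : Ty} (t : Term Γ A) :
    ∀ {Δ : Ctx} (σ : Subst Γ Δ) (e : Env Q Δ),
      (t.subst σ).sem e = t.sem (fun B x => (σ B x).sem e) := by
  induction t with
  | var x => intros; rfl
  | lam B t ih =>
    intro Δ σ e
    funext q
    simp only [Term.subst, Term.sem, ih]
    congr 1
    funext C x
    cases x with
    | here => rfl
    | there x => exact Term.sem_weaken _ _ _
  | app t u iht ihu => intro Δ σ e; simp only [Term.subst, Term.sem, iht, ihu]
  | pair t u iht ihu => intro Δ σ e; exact Prod.ext (iht σ e) (ihu σ e)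
  | fst t ih => intro Δ σ e; simp only [Term.subst, Term.sem, ih]
  | snd t ih => intro Δ σ e; simp only [Term.subst, Term.sem, ih]
  | star => intros; rfl

/-- The interpretation is invariant under beta-eta-conversion. -/
theorem Conv.sem_eq {Q : Type} {Γ : Ctx} {A : Ty} {t u : Term Γ A} (h : Conv t u) :
    ∀ e : Env Q Γ, t.sem e = u.sem e := by
  induction h with
  | refl t => intro e; rfl
  | symm _ ih => intro e; exact (ih e).symm
  | trans _ _ ih₁ ih₂ => intro e; exact (ih₁ e).trans (ih₂ e)
  | lam _ ih => intro e; funext q; exact ih _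
  | app _ _ ih₁ ih₂ => intro e; simp only [Term.sem, ih₁, ih₂]
  | pair _ _ ih₁ ih₂ => intro e; exact Prod.ext (ih₁ e) (ih₂ e)
  | fst _ ih => intro e; simp only [Term.sem, ih]
  | snd _ ih => intro e; simp only [Term.sem, ih]
  | arr_beta t u =>
    intro e
    simp only [Term.sem, Term.inst, Term.sem_subst]
    congr 1
    funext C x
    cases x <;> rfl
  | arr_eta t =>
    intro e
    funext q
    simp only [Term.sem, Term.sem_weaken, Env.cons]
  | fst_beta t u => intro e; rfl
  | snd_beta t u => intro e; rfl
  | prod_eta t => intro e; rfl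
  | unit_eta t => intro e; rfl

/-- The semantic bracket: the interpretation over `Q` of a closed term modulo
beta-eta-conversion. -/
def Tm.sem (Q : Type) {A : Ty} (t : Tm A) : SemTy Q A :=
  Quotient.lift (s := convSetoid A) (fun M : Term [] A => M.sem (Env.nil (Q := Q)))
    (fun _ _ h => Conv.sem_eq h _) t

/-- The language of closed terms of type `A` whose interpretation over `Q` lies in `F`. -/
def Lang {Q : Type} {A : Ty} (F : Set (SemTy Q A)) : Set (Tm A) :=
  {t | t.sem Q ∈ F}

/-- A language of terms is recognizable in finite sets if it is `Lang F` for some finite set `Q`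
and some set `F` of elements of the interpretation over `Q` of its type. -/
def FinSetRecognizable {A : Ty} (L : Set (Tm A)) : Prop :=
  ∃ Q : Type, Finite Q ∧ ∃ F : Set (SemTy Q A), L = Lang F

/-! ### Untyped terms, their encoding, affine terms -/

/-- `Scoped n`: the untyped terms, with de Bruijn indices, all of whose free variables are among
the `n` indices `0, …, n - 1` (index `0` is the most recently bound variable). -/
inductive Scoped : ℕ → Type
  | var {n : ℕ} : Fin n → Scoped n
  | abs {n : ℕ} : Scoped (n + 1) → Scoped n
  | app {n : ℕ} : Scoped n → Scoped n → Scoped n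

/-- The type `(o → o) → o` of the constructor for abstractions. -/
abbrev absTy : Ty := Ty.arr (Ty.arr Ty.o Ty.o) Ty.o

/-- The type `o → o → o` of the constructor for applications. -/
abbrev appTy : Ty := Ty.arr Ty.o (Ty.arr Ty.o Ty.o)

/-- The type `((o → o) → o) → (o → o → o) → o` of encodings of closed untyped terms. -/
abbrev untypedTy : Ty := Ty.arr absTy (Ty.arr appTy Ty.o)

/-- The context `ℓ : (o → o) → o, a : o → o → o, x₁ : o, …, xₙ : o`. -/
def encCtx : ℕ → Ctx
  | 0 => [appTy, absTy]
  | n + 1 => Ty.o :: encCtx n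

/-- The variable `ℓ`. -/
def absVar : (n : ℕ) → Var (encCtx n) absTy
  | 0 => Var.there Var.here
  | n + 1 => Var.there (absVar n)

/-- The variable `a`. -/
def appVar : (n : ℕ) → Var (encCtx n) appTy
  | 0 => Var.here
  | n + 1 => Var.there (appVar n)

/-- The variable of type `o` with de Bruijn index `i`. -/
def baseVar : (n : ℕ) → Fin n → Var (encCtx n) Ty.o
  | 0, i => i.elim0
  | n + 1, i => Fin.cases (motive := fun _ => Var (encCtx (n + 1)) Ty.o)
      Var.here (fun j => Var.there (baseVar n j)) i

/-- The encoding of scoped untyped terms as simply typed terms of type `o`. -/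
def Scoped.enc : {n : ℕ} → Scoped n → Term (encCtx n) Ty.o
  | n, Scoped.var i => Term.var (baseVar n i)
  | n, Scoped.abs u => Term.app (Term.var (absVar n)) (Term.lam Ty.o (Scoped.enc u))
  | n, Scoped.app u v =>
      Term.app (Term.app (Term.var (appVar n)) (Scoped.enc u)) (Scoped.enc v)

/-- The encoding `λ ℓ. λ a. enc u` of a closed untyped term `u`, modulo beta-eta-conversion. -/
def encode (u : Scoped 0) : Tm untypedTy :=
  Quotient.mk (convSetoid untypedTy) (Term.lam absTy (Term.lam appTy (Scoped.enc u)))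

/-- The number of occurrences of the free variable with index `i`. -/
def Scoped.occ : {n : ℕ} → Fin n → Scoped n → ℕ
  | _, i, Scoped.var j => if i = j then 1 else 0
  | _, i, Scoped.abs u => Scoped.occ i.succ u
  | _, i, Scoped.app u v => Scoped.occ i u + Scoped.occ i v

/-- Every variable bound in the term occurs at most once. -/
def Scoped.IsAffine : {n : ℕ} → Scoped n → Prop
  | _, Scoped.var _ => True
  | _, Scoped.abs u => Scoped.occ 0 u ≤ 1 ∧ Scoped.IsAffine u
  | _, Scoped.app u v => Scoped.IsAffine u ∧ Scoped.IsAffine v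

/-- The language of encodings of closed affine untyped terms. -/
def affineLanguage : Set (Tm untypedTy) :=
  {t | ∃ u : Scoped 0, u.IsAffine ∧ encode u = t}

/-! ### The finite interpretation -/

/-- The set `{0, 1, ∞}`. -/
inductive Trunc3 : Type
  | zero : Trunc3
  | one : Trunc3
  | infty : Trunc3
  deriving DecidableEq

instance : Fintype Trunc3 :=
  ⟨{Trunc3.zero, Trunc3.one, Trunc3.infty}, fun x => by cases x <;> decide⟩

/-- Addition of natural numbers, truncated by `2 = 3 = ⋯ = ∞`. -/
def Trunc3.add : Trunc3 → Trunc3 → Trunc3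
  | Trunc3.zero, y => y
  | x, Trunc3.zero => x
  | _, _ => Trunc3.infty

/-- The finite set `{0, 1, ∞} × {⊤, ⊥}`. -/
abbrev AffQ : Type := Trunc3 × Bool

/-- The interpretation of abstraction. -/
def fabs (g : AffQ → AffQ) : AffQ :=
  ((g (Trunc3.zero, true)).1,
    (g (Trunc3.zero, true)).2 && decide ((g (Trunc3.one, true)).1 ≠ Trunc3.infty))

/-- The interpretation of application. -/
def fapp (p q : AffQ) : AffQ :=
  (Trunc3.add p.1 q.1, p.2 && q.2)

/-- The value in `Q`, for `Q = {0, 1, ∞} × {⊤, ⊥}`, of an element of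
`((Q → Q) → Q) → (Q → Q → Q) → Q` at the interpretations of abstraction and application. -/
def evalAff (s : SemTy AffQ untypedTy) : AffQ :=
  (show ((AffQ → AffQ) → AffQ) → (AffQ → AffQ → AffQ) → AffQ from s) fabs fapp

end AffineLang

open AffineLang

namespace AffineLang

/-! ### Renaming and substitution -/

/-! Interpreting `encode u` at operations `l`, `a` amounts to folding `u` with them (`sem_encode`),
so everything except surjectivity of `encode` follows from choosing `l` and `a` well. Injectivity:
over functions from ℕ to `LevelTerm`, the fold rebuilds `u` with de Bruijn levels
(`Scoped.eq_of_fold_eq`), and convertible terms have equal interpretations. Affineness: over `AffQ`,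
the first component of the fold is the truncated number of occurrences of the variable valued 1
(`Scoped.fold_fst`). Testing the body of an abstraction at 1 thus detects a repeated bound variable,
and testing it at 0 collects the verdict on its subterms (`Scoped.fold_snd`). Surjectivity avoids
normal forms: the Kripke predicate `Reducible` means "convertible to an encoding" at type `o`. It
holds of ℓ and a, and by `Term.reducible_subst` of every closed term, so `t ℓ a` is convertible to
an encoding, and η recovers `t`. Every element of `Tm untypedTy` is then an encoding, so the
languages need only be compared on encodings. -/

theorem Ren.lift_id {Γ : Ctx} (B : Ty) :
    Ren.lift (fun _ x => x : Ren Γ Γ) B = fun _ x => x := by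
  funext C x
  cases x <;> rfl

theorem Ren.lift_comp {Γ Δ Θ : Ctx} (ρ : Ren Γ Δ) (τ : Ren Δ Θ) (B : Ty) :
    Ren.lift (fun C x => τ C (ρ C x)) B = fun C x => Ren.lift τ B C (Ren.lift ρ B C x) := by
  funext C x
  cases x <;> rfl

theorem Term.rename_id {Γ : Ctx} {A : Ty} (t : Term Γ A) : t.rename (fun _ x => x) = t := by
  induction t with
  | var x => rfl
  | lam B t ih => simp only [Term.rename, Ren.lift_id, ih]
  | app t u iht ihu => simp only [Term.rename, iht, ihu]
  | pair t u iht ihu => simp only [Term.rename, iht, ihu]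
  | fst t ih => simp only [Term.rename, ih]
  | snd t ih => simp only [Term.rename, ih]
  | star => rfl

theorem Term.rename_rename {Γ : Ctx} {A : Ty} (t : Term Γ A) :
    ∀ {Δ Θ : Ctx} (ρ : Ren Γ Δ) (τ : Ren Δ Θ),
      (t.rename ρ).rename τ = t.rename (fun B x => τ B (ρ B x)) := by
  induction t with
  | var x => intros; rfl
  | lam B t ih => intros; simp only [Term.rename, ih, Ren.lift_comp]
  | app t u iht ihu => intros; simp only [Term.rename, iht, ihu]
  | pair t u iht ihu => intros; simp only [Term.rename, iht, ihu]
  | fst t ih => intros; simp only [Term.rename, ih]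
  | snd t ih => intros; simp only [Term.rename, ih]
  | star => intros; rfl

theorem Term.rename_weaken {Γ Δ : Ctx} {A : Ty} (t : Term Γ A) (ρ : Ren Γ Δ) (B : Ty) :
    (t.weaken B).rename (Ren.lift ρ B) = (t.rename ρ).weaken B := by
  simp only [Term.weaken, Term.rename_rename]
  rfl

theorem Subst.lift_ren {Γ Δ Θ : Ctx} (ρ : Ren Γ Δ) (σ : Subst Δ Θ) (B : Ty) :
    Subst.lift (fun C x => σ C (ρ C x)) B = fun C x => Subst.lift σ B C (Ren.lift ρ B C x) := by
  funext C x
  cases x <;> rfl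

theorem Term.subst_rename {Γ : Ctx} {A : Ty} (t : Term Γ A) :
    ∀ {Δ Θ : Ctx} (ρ : Ren Γ Δ) (σ : Subst Δ Θ),
      (t.rename ρ).subst σ = t.subst (fun B x => σ B (ρ B x)) := by
  induction t with
  | var x => intros; rfl
  | lam B t ih => intros; simp only [Term.rename, Term.subst, ih, Subst.lift_ren]
  | app t u iht ihu => intros; simp only [Term.rename, Term.subst, iht, ihu]
  | pair t u iht ihu => intros; simp only [Term.rename, Term.subst, iht, ihu]
  | fst t ih => intros; simp only [Term.rename, Term.subst, ih]
  | snd t ih => intros; simp only [Term.rename, Term.subst, ih]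
  | star => intros; rfl

theorem Subst.lift_rename {Γ Δ Θ : Ctx} (σ : Subst Γ Δ) (ρ : Ren Δ Θ) (B : Ty) :
    Subst.lift (fun C x => (σ C x).rename ρ) B =
      fun C x => (Subst.lift σ B C x).rename (Ren.lift ρ B) := by
  funext C x
  cases x with
  | here => rfl
  | there x => exact (Term.rename_weaken _ _ _).symm

theorem Term.rename_subst {Γ : Ctx} {A : Ty} (t : Term Γ A) :
    ∀ {Δ Θ : Ctx} (σ : Subst Γ Δ) (ρ : Ren Δ Θ),
      (t.subst σ).rename ρ = t.subst (fun B x => (σ B x).rename ρ) := by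
  induction t with
  | var x => intros; rfl
  | lam B t ih => intros; simp only [Term.rename, Term.subst, ih, Subst.lift_rename]
  | app t u iht ihu => intros; simp only [Term.rename, Term.subst, iht, ihu]
  | pair t u iht ihu => intros; simp only [Term.rename, Term.subst, iht, ihu]
  | fst t ih => intros; simp only [Term.rename, Term.subst, ih]
  | snd t ih => intros; simp only [Term.rename, Term.subst, ih]
  | star => intros; rfl

theorem Subst.lift_var {Γ : Ctx} (B : Ty) :
    Subst.lift (fun _ x => Term.var x : Subst Γ Γ) B = fun _ x => Term.var x := by
  funext C x
  cases x <;> rfl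

theorem Term.subst_var {Γ : Ctx} {A : Ty} (t : Term Γ A) :
    t.subst (fun _ x => Term.var x) = t := by
  induction t with
  | var x => rfl
  | lam B t ih => simp only [Term.subst, Subst.lift_var, ih]
  | app t u iht ihu => simp only [Term.subst, iht, ihu]
  | pair t u iht ihu => simp only [Term.subst, iht, ihu]
  | fst t ih => simp only [Term.subst, ih]
  | snd t ih => simp only [Term.subst, ih]
  | star => rfl

/-- Lifting a substitution weakens its values, and weakening is a renaming; hence both mixed
composition laws are needed before substitutions can be composed. -/
theorem Subst.lift_subst {Γ Δ Θ : Ctx} (σ : Subst Γ Δ) (τ : Subst Δ Θ) (B : Ty) :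
    Subst.lift (fun C x => (σ C x).subst τ) B =
      fun C x => (Subst.lift σ B C x).subst (Subst.lift τ B) := by
  funext C x
  cases x with
  | here => rfl
  | there x =>
    simp only [Subst.lift, Term.weaken, Term.subst_rename, Term.rename_subst]

theorem Term.subst_subst {Γ : Ctx} {A : Ty} (t : Term Γ A) :
    ∀ {Δ Θ : Ctx} (σ : Subst Γ Δ) (τ : Subst Δ Θ),
      (t.subst σ).subst τ = t.subst (fun B x => (σ B x).subst τ) := by
  induction t with
  | var x => intros; rfl
  | lam B t ih => intros; simp only [Term.subst, ih, Subst.lift_subst]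
  | app t u iht ihu => intros; simp only [Term.subst, iht, ihu]
  | pair t u iht ihu => intros; simp only [Term.subst, iht, ihu]
  | fst t ih => intros; simp only [Term.subst, ih]
  | snd t ih => intros; simp only [Term.subst, ih]
  | star => intros; rfl

theorem Term.inst_weaken {Γ : Ctx} {A B : Ty} (t : Term Γ A) (s : Term Γ B) :
    (t.weaken B).inst s = t := by
  simp only [Term.inst, Term.weaken, Term.subst_rename]
  exact t.subst_var

/-- Extension of a substitution by a term for a fresh variable. -/
def Subst.cons {Γ Δ : Ctx} {B : Ty} (s : Term Δ B) (σ : Subst Γ Δ) : Subst (B :: Γ) Δ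
  | _, Var.here => s
  | _, Var.there x => σ _ x

/-- The substitution for the empty context. -/
def Subst.nil {Δ : Ctx} : Subst [] Δ := fun _ x => nomatch x

theorem Term.inst_subst_lift {Γ Δ : Ctx} {A B : Ty} (t : Term (B :: Γ) A) (σ : Subst Γ Δ)
    (s : Term Δ B) : (t.subst (Subst.lift σ B)).inst s = t.subst (Subst.cons s σ) := by
  rw [Term.inst, Term.subst_subst]
  congr 1
  funext C x
  cases x with
  | here => rfl
  | there x => exact Term.inst_weaken _ _

theorem Term.rename_inst {Γ Δ : Ctx} {A B : Ty} (t : Term (B :: Γ) A) (s : Term Γ B)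
    (ρ : Ren Γ Δ) : (t.inst s).rename ρ = (t.rename (Ren.lift ρ B)).inst (s.rename ρ) := by
  rw [Term.inst, Term.inst, Term.rename_subst, Term.subst_rename]
  congr 1
  funext C x
  cases x <;> rfl

/-- Conversion is stable under renaming. -/
theorem Conv.rename {Γ : Ctx} {A : Ty} {t u : Term Γ A} (h : Conv t u) :
    ∀ {Δ : Ctx} (ρ : Ren Γ Δ), Conv (t.rename ρ) (u.rename ρ) := by
  induction h with
  | refl t => intros; exact Conv.refl _
  | symm _ ih => intro _ ρ; exact (ih ρ).symm
  | trans _ _ ih₁ ih₂ => intro _ ρ; exact (ih₁ ρ).trans (ih₂ ρ)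
  | lam _ ih => intro _ ρ; exact Conv.lam (ih _)
  | app _ _ ih₁ ih₂ => intro _ ρ; exact Conv.app (ih₁ ρ) (ih₂ ρ)
  | pair _ _ ih₁ ih₂ => intro _ ρ; exact Conv.pair (ih₁ ρ) (ih₂ ρ)
  | fst _ ih => intro _ ρ; exact Conv.fst (ih ρ)
  | snd _ ih => intro _ ρ; exact Conv.snd (ih ρ)
  | arr_beta t u => intro _ ρ; rw [Term.rename_inst]; exact Conv.arr_beta _ _
  | arr_eta t =>
    intro _ ρ
    simp only [Term.rename, Term.rename_weaken]
    exact Conv.arr_eta _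
  | fst_beta t u => intro _ ρ; exact Conv.fst_beta _ _
  | snd_beta t u => intro _ ρ; exact Conv.snd_beta _ _
  | prod_eta t => intro _ ρ; exact Conv.prod_eta _
  | unit_eta t => intro _ ρ; exact Conv.unit_eta _

/-! ### Every closed term is convertible to an encoding -/

/-- The renamings between encoding contexts that fix `ℓ` and `a` and send the other variables
of the first context to such variables of the second one. -/
structure Ren.IsEnc {n m : ℕ} (ρ : Ren (encCtx n) (encCtx m)) : Prop where
  abs : ρ _ (absVar n) = absVar m
  app : ρ _ (appVar n) = appVar m
  base : ∀ i : Fin n, ∃ j : Fin m, ρ _ (baseVar n i) = baseVar m j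

theorem Ren.IsEnc.id (n : ℕ) : Ren.IsEnc (fun _ x => x : Ren (encCtx n) (encCtx n)) :=
  ⟨rfl, rfl, fun i => ⟨i, rfl⟩⟩

theorem Ren.IsEnc.comp {n m k : ℕ} {ρ : Ren (encCtx n) (encCtx m)}
    {τ : Ren (encCtx m) (encCtx k)} (hρ : ρ.IsEnc) (hτ : τ.IsEnc) :
    Ren.IsEnc (fun B x => τ B (ρ B x)) where
  abs := by rw [hρ.abs, hτ.abs]
  app := by rw [hρ.app, hτ.app]
  base i := by
    obtain ⟨j, hj⟩ := hρ.base i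
    obtain ⟨l, hl⟩ := hτ.base j
    exact ⟨l, by rw [hj, hl]⟩

theorem Ren.IsEnc.there (n : ℕ) :
    Ren.IsEnc (n := n) (m := n + 1) (fun _ x => Var.there x) :=
  ⟨rfl, rfl, fun i => ⟨i.succ, rfl⟩⟩

theorem Ren.IsEnc.lift {n m : ℕ} {ρ : Ren (encCtx n) (encCtx m)} (hρ : ρ.IsEnc) :
    Ren.IsEnc (n := n + 1) (m := m + 1) (Ren.lift ρ Ty.o) where
  abs := congrArg Var.there hρ.abs
  app := congrArg Var.there hρ.app
  base i := by
    cases i using Fin.cases with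
    | zero => exact ⟨0, rfl⟩
    | succ i =>
      obtain ⟨j, hj⟩ := hρ.base i
      exact ⟨j.succ, congrArg Var.there hj⟩

/-- This is what makes the base case of `Reducible` stable under renaming. The equality is
syntactic: an encoding uses only ℓ, a and base variables, whose kinds `Ren.IsEnc` preserves. -/
theorem Scoped.exists_enc_eq_rename {n : ℕ} (u : Scoped n) :
    ∀ {m : ℕ} {ρ : Ren (encCtx n) (encCtx m)}, ρ.IsEnc →
      ∃ v : Scoped m, (u.enc).rename ρ = v.enc := by
  induction u with
  | var i =>
    intro m ρ hρ
    obtain ⟨j, hj⟩ := hρ.base i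
    exact ⟨Scoped.var j, congrArg Term.var hj⟩
  | abs u ih =>
    intro m ρ hρ
    obtain ⟨v, hv⟩ := ih hρ.lift
    exact ⟨Scoped.abs v, by
      simp only [Scoped.enc, Term.rename, hρ.abs]
      exact congrArg (fun t => Term.app _ (Term.lam Ty.o t)) hv⟩
  | app u v ihu ihv =>
    intro m ρ hρ
    obtain ⟨u', hu⟩ := ihu hρ
    obtain ⟨v', hv⟩ := ihv hρ
    exact ⟨Scoped.app u' v', by simp only [Scoped.enc, Term.rename, hρ.app, hu, hv]⟩

/-- The Kripke logical predicate on terms in encoding contexts which, at the base type, says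
that the term is convertible to an encoding. -/
def Reducible : (A : Ty) → (n : ℕ) → Term (encCtx n) A → Prop
  | Ty.o, _, t => ∃ u : Scoped _, Conv t u.enc
  | Ty.arr A B, n, t => ∀ (m : ℕ) (ρ : Ren (encCtx n) (encCtx m)), ρ.IsEnc →
      ∀ s : Term (encCtx m) A, Reducible A m s → Reducible B m (Term.app (t.rename ρ) s)
  | Ty.prod A B, n, t => Reducible A n t.fst ∧ Reducible B n t.snd
  | Ty.unit, _, _ => True

theorem Reducible.conv {A : Ty} : ∀ {n : ℕ} {t u : Term (encCtx n) A},
    Conv t u → Reducible A n u → Reducible A n t := by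
  induction A with
  | o => intro n t u h ⟨v, hv⟩; exact ⟨v, h.trans hv⟩
  | arr A B _ ihB =>
    intro n t u h hu m ρ hρ s hs
    exact ihB (Conv.app (h.rename ρ) (Conv.refl s)) (hu m ρ hρ s hs)
  | prod A B ihA ihB =>
    intro n t u h hu
    exact ⟨ihA h.fst hu.1, ihB h.snd hu.2⟩
  | unit => intros; trivial

theorem Reducible.rename {A : Ty} : ∀ {n m : ℕ} {t : Term (encCtx n) A}
    {ρ : Ren (encCtx n) (encCtx m)}, ρ.IsEnc → Reducible A n t → Reducible A m (t.rename ρ) := by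
  induction A with
  | o =>
    intro n m t ρ hρ ⟨u, hu⟩
    obtain ⟨v, hv⟩ := u.exists_enc_eq_rename hρ
    exact ⟨v, hv ▸ hu.rename ρ⟩
  | arr A B _ _ =>
    intro n m t ρ hρ ht k τ hτ s hs
    rw [Term.rename_rename]
    exact ht k _ (hρ.comp hτ) s hs
  | prod A B ihA ihB =>
    intro n m t ρ hρ ht
    exact ⟨ihA hρ ht.1, ihB hρ ht.2⟩
  | unit => intros; trivial

/-- The fundamental lemma of the logical predicate. -/
theorem Term.reducible_subst {Γ : Ctx} {A : Ty} (t : Term Γ A) :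
    ∀ {n : ℕ} (σ : Subst Γ (encCtx n)), (∀ B x, Reducible B n (σ B x)) →
      Reducible A n (t.subst σ) := by
  induction t with
  | var x => intro n σ hσ; exact hσ _ x
  | lam B t ih =>
    intro n σ hσ m ρ hρ s hs
    refine Reducible.conv (Conv.arr_beta _ _) ?_
    -- Moving the renaming into the substitution turns the β-contractum into a single substitution
    -- that sends the bound variable to `s`, to which the induction hypothesis applies.
    rw [Term.rename_subst, ← Subst.lift_rename, Term.inst_subst_lift]
    refine ih _ fun C x => ?_
    cases x with
    | here => exact hs
    | there x => exact (hσ _ x).rename hρ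
  | app t u iht ihu =>
    intro n σ hσ
    have h := iht σ hσ n _ (Ren.IsEnc.id n) _ (ihu σ hσ)
    rwa [Term.rename_id] at h
  | pair t u iht ihu =>
    intro n σ hσ
    exact ⟨(iht σ hσ).conv (Conv.fst_beta _ _), (ihu σ hσ).conv (Conv.snd_beta _ _)⟩
  | fst t ih => intro n σ hσ; exact (ih σ hσ).1
  | snd t ih => intro n σ hσ; exact (ih σ hσ).2
  | star => intros; trivial

theorem reducible_absVar (n : ℕ) : Reducible absTy n (Term.var (absVar n)) := by
  intro m ρ hρ s hs
  -- The Kripke quantification is used here: `s` is applied to a fresh variable, and η then presents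
  -- `s` as the abstraction of an encoding.
  obtain ⟨u, hu⟩ := hs (m + 1) _ (Ren.IsEnc.there m) (Term.var (baseVar (m + 1) 0))
    ⟨Scoped.var 0, Conv.refl _⟩
  refine ⟨Scoped.abs u, ?_⟩
  simp only [Term.rename, hρ.abs]
  exact Conv.app (Conv.refl _) ((Conv.arr_eta s).trans (Conv.lam hu))

theorem reducible_appVar (n : ℕ) : Reducible appTy n (Term.var (appVar n)) := by
  intro m ρ hρ s ⟨u, hu⟩ k τ hτ r ⟨v, hv⟩
  -- The second argument may live in a larger context, so the encoding of the first is transported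
  -- along `τ`.
  obtain ⟨u', hu'⟩ := u.exists_enc_eq_rename hτ
  refine ⟨Scoped.app u' v, ?_⟩
  simp only [Term.rename, hρ.app, hτ.app]
  exact Conv.app (Conv.app (Conv.refl _) (hu' ▸ hu.rename τ)) hv

theorem encode_surjective : Function.Surjective encode := by
  intro q
  induction q using Quotient.inductionOn with
  | h t =>
    have hred := t.reducible_subst (n := 0) Subst.nil (fun _ x => nomatch x)
    have h := hred 0 _ (Ren.IsEnc.id 0) _ (reducible_absVar 0) 0 _ (Ren.IsEnc.id 0) _
      (reducible_appVar 0)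
    obtain ⟨u, hu⟩ := h
    simp only [Term.rename_id] at hu
    refine ⟨u, Quotient.sound (s := convSetoid untypedTy) (Conv.symm ?_)⟩
    have hw : (t.weaken absTy).weaken appTy =
        t.subst Subst.nil := by
      -- Both sides become substitutions out of the empty context, which agree vacuously.
      conv_lhs => rw [← t.subst_var]
      simp only [Term.weaken, Term.rename_subst]
      congr 1
      funext B x
      nomatch x
    refine (Conv.arr_eta t).trans (Conv.lam ((Conv.arr_eta _).trans (Conv.lam ?_)))
    have hw' : (Term.app (t.weaken absTy) (Term.var Var.here)).weaken appTy =
        Term.app ((t.weaken absTy).weaken appTy) (Term.var (Var.there Var.here)) := rfl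
    rw [hw', hw]
    exact hu

/-! ### Encodings of distinct terms are not convertible -/

/-- Untyped terms with de Bruijn levels, possibly ill-scoped. -/
inductive LevelTerm : Type
  | var : ℕ → LevelTerm
  | abs : LevelTerm → LevelTerm
  | app : LevelTerm → LevelTerm → LevelTerm

/-- Abstraction of terms given as functions of the first unused level. -/
def LevelTerm.absFun (g : (ℕ → LevelTerm) → ℕ → LevelTerm) (n : ℕ) : LevelTerm :=
  LevelTerm.abs (g (fun _ => LevelTerm.var n) (n + 1))

/-- Application of terms given as functions of the first unused level. -/
def LevelTerm.appFun (p q : ℕ → LevelTerm) (n : ℕ) : LevelTerm :=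
  LevelTerm.app (p n) (q n)

/-- The valuation of an encoding context with given values of its variables. -/
def Env.enc {Q : Type} (l : (Q → Q) → Q) (a : Q → Q → Q) :
    (n : ℕ) → (Fin n → Q) → Env Q (encCtx n)
  | 0, _ => Env.cons (B := appTy) a (Env.cons (B := absTy) l Env.nil)
  | n + 1, e => Env.cons (B := Ty.o) (e 0) (Env.enc l a n (fun i => e i.succ))

theorem Env.enc_absVar {Q : Type} (l : (Q → Q) → Q) (a : Q → Q → Q) :
    ∀ (n : ℕ) (e : Fin n → Q), Env.enc l a n e _ (absVar n) = l
  | 0, _ => rfl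
  | n + 1, _ => Env.enc_absVar l a n _

theorem Env.enc_appVar {Q : Type} (l : (Q → Q) → Q) (a : Q → Q → Q) :
    ∀ (n : ℕ) (e : Fin n → Q), Env.enc l a n e _ (appVar n) = a
  | 0, _ => rfl
  | n + 1, _ => Env.enc_appVar l a n _

theorem Env.enc_baseVar {Q : Type} (l : (Q → Q) → Q) (a : Q → Q → Q) :
    ∀ (n : ℕ) (e : Fin n → Q) (i : Fin n), Env.enc l a n e _ (baseVar n i) = e i
  | n + 1, e, i => by
    cases i using Fin.cases with
    | zero => rfl
    | succ i => exact Env.enc_baseVar l a n _ i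

/-- The fold of an untyped term over a set with abstraction and application operations. -/
def Scoped.fold {Q : Type} (l : (Q → Q) → Q) (a : Q → Q → Q) :
    {n : ℕ} → Scoped n → (Fin n → Q) → Q
  | _, Scoped.var i, e => e i
  | _, Scoped.abs u, e => l (fun q => Scoped.fold l a u (Fin.cons q e))
  | _, Scoped.app u v, e => a (Scoped.fold l a u e) (Scoped.fold l a v e)

theorem Scoped.sem_enc {Q : Type} (l : (Q → Q) → Q) (a : Q → Q → Q) {n : ℕ} (u : Scoped n) :
    ∀ e : Fin n → Q, u.enc.sem (Env.enc l a n e) = u.fold l a e := by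
  induction u with
  | var i => intro e; exact Env.enc_baseVar l a _ e i
  | abs u ih =>
    intro e
    simp only [Scoped.enc, Term.sem, Env.enc_absVar]
    exact congrArg l (funext fun q => ih (Fin.cons q e))
  | app u v ihu ihv =>
    intro e
    simp only [Scoped.enc, Term.sem, Env.enc_appVar, Scoped.fold]
    rw [ihu e, ihv e]

/-- For the induction to pass under binders, the statement covers open terms: index `i` among `n`
variables has level `n - 1 - i`, and `n` is the first unused level. -/
theorem Scoped.eq_of_fold_eq {n : ℕ} (u v : Scoped n)
    (h : u.fold LevelTerm.absFun LevelTerm.appFun (fun i _ => LevelTerm.var (n - 1 - i)) n =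
      v.fold LevelTerm.absFun LevelTerm.appFun (fun i _ => LevelTerm.var (n - 1 - i)) n) :
    u = v := by
  induction u with
  | var i =>
    cases v with
    | var j =>
      injection h with h
      congr 1
      omega
    | abs v => nomatch h
    | app v w => nomatch h
  | @abs n u ih =>
    cases v with
    | var j => nomatch h
    | abs v =>
      -- The new variable, index 0, gets level `n`; each old index rises by one together with the
      -- number of variables, so its level is unchanged.
      have he : (Fin.cons (fun _ => LevelTerm.var n)
          (fun (i : Fin n) (_ : ℕ) => LevelTerm.var (n - 1 - i)) : Fin (n + 1) → ℕ → LevelTerm) =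
          fun (i : Fin (n + 1)) (_ : ℕ) => LevelTerm.var (n + 1 - 1 - i) := by
        funext i k
        cases i using Fin.cases with
        | zero => rfl
        | succ i => simp only [Fin.cons_succ, Fin.val_succ]; congr 1; omega
      simp only [Scoped.fold, LevelTerm.absFun, he] at h
      injection h with h
      rw [ih v h]
    | app v w => nomatch h
  | app u u' ih ih' =>
    cases v with
    | var j => nomatch h
    | abs v => nomatch h
    | app v w =>
      simp only [Scoped.fold, LevelTerm.appFun] at h
      injection h with h h'
      rw [ih v h, ih' w h']

theorem sem_encode {Q : Type} (l : (Q → Q) → Q) (a : Q → Q → Q) (u : Scoped 0) :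
    (show ((Q → Q) → Q) → (Q → Q → Q) → Q from (encode u).sem Q) l a =
      u.fold l a (fun i => i.elim0) :=
  u.sem_enc l a _

theorem encode_injective : Function.Injective encode := by
  intro u v h
  apply Scoped.eq_of_fold_eq
  have hsem := (sem_encode LevelTerm.absFun LevelTerm.appFun u).symm.trans
    ((by rw [h] : _ = _).trans (sem_encode LevelTerm.absFun LevelTerm.appFun v))
  have he : (fun (i : Fin 0) (_ : ℕ) => LevelTerm.var (0 - 1 - i)) = fun i => i.elim0 := by
    funext i
    exact i.elim0
  rw [he, hsem]

/-! ### Affine terms -/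

/-- The truncation of a natural number. -/
def Trunc3.trunc : ℕ → Trunc3
  | 0 => Trunc3.zero
  | 1 => Trunc3.one
  | _ => Trunc3.infty

theorem Trunc3.trunc_add (m n : ℕ) :
    Trunc3.trunc (m + n) = Trunc3.add (Trunc3.trunc m) (Trunc3.trunc n) := by
  match m, n with
  | 0, n => rw [Nat.zero_add]; rfl
  | 1, 0 => rfl
  | m + 2, 0 => rfl
  | 1, 1 => rfl
  | 1, n + 2 => rw [show 1 + (n + 2) = n + 1 + 2 by omega]; rfl
  | m + 2, 1 => rfl
  | m + 2, n + 2 => rw [show m + 2 + (n + 2) = m + n + 2 + 2 by omega]; rfl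

theorem Trunc3.trunc_ne_infty {n : ℕ} : Trunc3.trunc n ≠ Trunc3.infty ↔ n ≤ 1 := by
  match n with
  | 0 => simp [Trunc3.trunc]
  | 1 => simp [Trunc3.trunc]
  | n + 2 => simp [Trunc3.trunc]

theorem Scoped.fold_fst_eq_zero {n : ℕ} (u : Scoped n) :
    ∀ e : Fin n → AffQ, (∀ i, (e i).1 = Trunc3.zero) → (u.fold fabs fapp e).1 = Trunc3.zero := by
  induction u with
  | var i => intro e he; exact he i
  | abs u ih => intro e he; exact ih _ (Fin.cases rfl he)
  | app u v ihu ihv => intro e he; simp only [Scoped.fold, fapp, ihu e he, ihv e he]; rfl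

/-- `fapp` adds first components, and `fabs` reads its first component at an argument of weight 0,
so bound variables contribute nothing to the count. -/
theorem Scoped.fold_fst {n : ℕ} (u : Scoped n) :
    ∀ (k : Fin n) (e : Fin n → AffQ),
      (∀ i, (e i).1 = if k = i then Trunc3.one else Trunc3.zero) →
      (u.fold fabs fapp e).1 = Trunc3.trunc (u.occ k) := by
  induction u with
  | var i =>
    intro k e he
    simp only [Scoped.fold, Scoped.occ, he]
    split <;> rfl
  | abs u ih =>
    intro k e he
    refine ih k.succ _ (Fin.cases ?_ fun i => ?_)
    · rw [if_neg (Fin.succ_ne_zero k)]; rfl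
    · simp only [Fin.cons_succ, he, Fin.succ_inj]
  | app u v ihu ihv =>
    intro k e he
    simp only [Scoped.fold, fapp, Scoped.occ, Trunc3.trunc_add, ihu k e he, ihv k e he]

theorem Scoped.fold_snd {n : ℕ} (u : Scoped n) :
    ∀ e : Fin n → AffQ, (∀ i, e i = (Trunc3.zero, true)) →
      ((u.fold fabs fapp e).2 = true ↔ u.IsAffine) := by
  induction u with
  | var i => intro e he; simp [Scoped.fold, Scoped.IsAffine, he]
  | abs u ih =>
    intro e he
    have h₁ := ih (Fin.cons (Trunc3.zero, true) e) (Fin.cases rfl he)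
    -- The test at 1 gives weight to the bound variable only, so its first component counts the
    -- occurrences of index 0.
    have h₂ := u.fold_fst 0 (Fin.cons (Trunc3.one, true) e) (Fin.cases rfl fun i => by
      rw [if_neg (Fin.succ_ne_zero i).symm, Fin.cons_succ, he])
    simp only [Scoped.fold, fabs, Scoped.IsAffine, Bool.and_eq_true, decide_eq_true_eq, h₁, h₂,
      Trunc3.trunc_ne_infty]
    exact And.comm
  | app u v ihu ihv =>
    intro e he
    simp only [Scoped.fold, fapp, Scoped.IsAffine, Bool.and_eq_true, ihu e he, ihv e he]

theorem evalAff_encode (u : Scoped 0) :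
    (evalAff ((encode u).sem AffQ)).1 = Trunc3.zero ∧
      ((evalAff ((encode u).sem AffQ)).2 = true ↔ u.IsAffine) := by
  have h : evalAff ((encode u).sem AffQ) = u.fold fabs fapp (fun i => i.elim0) :=
    sem_encode fabs fapp u
  rw [h]
  exact ⟨u.fold_fst_eq_zero _ fun i => i.elim0, u.fold_snd _ fun i => i.elim0⟩

/-- Surjectivity of `encode` suffices here: the semantic criterion already shows that affineness
depends only on the encoding. -/
theorem affineLanguage_eq_lang_snd :
    affineLanguage = Lang {s : SemTy AffQ untypedTy | (evalAff s).2 = true} := by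
  ext t
  obtain ⟨u, rfl⟩ := encode_surjective t
  constructor
  · rintro ⟨v, hv, h⟩
    rw [← h]
    exact (evalAff_encode v).2.2 hv
  · intro h
    exact ⟨u, (evalAff_encode u).2.1 h, rfl⟩

theorem affineLanguage_eq_lang :
    affineLanguage = Lang {s : SemTy AffQ untypedTy | evalAff s = (Trunc3.zero, true)} := by
  rw [affineLanguage_eq_lang_snd]
  ext t
  obtain ⟨u, rfl⟩ := encode_surjective t
  exact ⟨fun h => Prod.ext (evalAff_encode u).1 h, fun h => congrArg Prod.snd h⟩

end AffineLang

theorem mainTheorem8 :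
    Function.Bijective encode ∧
    (∀ u : Scoped 0, ∃ b : Bool,
      evalAff ((encode u).sem AffQ) = (Trunc3.zero, b) ∧ (b = true ↔ u.IsAffine)) ∧
    affineLanguage =
      Lang {s : SemTy AffQ untypedTy | evalAff s = (Trunc3.zero, true)} ∧
    affineLanguage =
      Lang {s : SemTy AffQ untypedTy | (evalAff s).2 = true} ∧
    FinSetRecognizable affineLanguage := by
  refine ⟨⟨encode_injective, encode_surjective⟩, fun u => ?_, affineLanguage_eq_lang,
    affineLanguage_eq_lang_snd, AffQ, inferInstance, _, affineLanguage_eq_lang⟩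
  obtain ⟨h₁, h₂⟩ := evalAff_encode u
  exact ⟨_, Prod.ext h₁ rfl, h₂⟩
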